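/- Let $\Delta_1,\Delta_2,\dots$ be i.i.d. almost surely positive random variables with $\mathbb E[\Delta_1]=\infty$ and $$P(\Delta_1\ge x)=x^{-1}\ell(x)\qquad\text{for all } x\ge 1,$$ where $\ell$ is slowly varying at infinity (the case of tail index $\alpha=1$). Put $T_n=\Delta_1+\dots+\Delta_n$ and $\ell^*(y)=\int_1^y \frac{\ell(x)}{x}\,dx$, and for each $n\ge1$ let $b_n$ be a quantile of order $1-1/n$ of $\Delta_1$, i.e. $P(\Delta_1<b_n)\le 1-\frac1n\le P(\Delta_1\le b_n)$. (a) If $\mathbb E[T_m^{-1}]<\infty$ for some $m\ge1$, then $\mathbb E\big[\big(\frac{T_n}{b_n}\frac{\ell(b_n)}{\ell^*(b_n)}\big)^{-1}\big]$ is finite for all large $n$ and $$\mathbb E\left[\left(\frac{T_n}{b_n}\,\frac{\ell(b_n)}{\ell^*(b_n)}\right)^{-1}\right]\longrightarrow 1\qquad(n\to\infty).$$ (b) Suppose that $V_1,V_2,\dots$ are random variables with $0<V_j\le1$ almost surely and that $\Delta_j=1/V_j$ satisfies the assumptions made on $\Delta_j$ before (a). Then the harmonic means $H_n=\dfrac{n}{1/V_1+\dots+1/V_n}$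 are integrable and $$\frac{b_n\,\ell^*(b_n)}{n\,\ell(b_n)}\,\mathbb E[H_n]\longrightarrow 1,\qquad \ell^*(b_n)\,\mathbb E[H_n]\longrightarrow 1 .$$ (c) If $U_1,U_2,\dots$ are i.i.d. uniform on $(0,1)$, then $\Delta_j=1/U_j$ satisfies the assumptions made on $\Delta_j$ before (a) with $\ell\equiv1$ and $b_n=n$, one has $\ell^*(n)=\ln n$ for all $n\ge1$, the harmonic means below are integrable, and $$(\ln n)\;\mathbb E\left[\frac{n}{\frac1{U_1}+\dots+\frac1{U_n}}\right]\longrightarrow 1 .$$ -/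

import Mathlib

open MeasureTheory ProbabilityTheory Filter Topology

/-- `ℓ` is slowly varying at infinity: on some half-line `[X, ∞)` it is measurable and positive, and
`ℓ (c x) / ℓ x → 1` as `x → ∞`, for every `c > 0`. -/
def SlowlyVarying (ℓ : ℝ → ℝ) : Prop :=
  (∃ X : ℝ, Measurable (fun x : Set.Ici X => ℓ x) ∧ ∀ x, X ≤ x → 0 < ℓ x) ∧
    ∀ c : ℝ, 0 < c → Tendsto (fun x => ℓ (c * x) / ℓ x) atTop (𝓝 1)

/-- `ℓ* (y) = ∫₁^y ℓ(x) / x dx`. -/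
noncomputable def ellStar (ℓ : ℝ → ℝ) (y : ℝ) : ℝ :=
  ∫ x in (1 : ℝ)..y, ℓ x / x

/-- `q` is a quantile of order `p` of the real random variable `X`:
`P (X < q) ≤ p ≤ P (X ≤ q)`. When `X` has a continuous distribution function `F` this says
`F q = p`. -/
def IsQuantile {Ω : Type*} [MeasurableSpace Ω] (μ : Measure Ω) (X : Ω → ℝ) (p q : ℝ) : Prop :=
  μ.real {ω | X ω < q} ≤ p ∧ p ≤ μ.real {ω | X ω ≤ q}

/-- The renewal process `T_n = Δ_1 + ⋯ + Δ_n` (the steps are indexed from `0`). -/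
def renewal {Ω : Type*} (Δ : ℕ → Ω → ℝ) (n : ℕ) (ω : Ω) : ℝ :=
  ∑ j ∈ Finset.range n, Δ j ω

/-- The harmonic mean `n / (1 / V_1 + ⋯ + 1 / V_n)` of the first `n` terms. -/
noncomputable def harmonicMean {Ω : Type*} (V : ℕ → Ω → ℝ) (n : ℕ) (ω : Ω) : ℝ :=
  n / ∑ j ∈ Finset.range n, 1 / V j ω

/-- The steps `Δ_j` are i.i.d., positive, of infinite mean, with tail `P (Δ_j ≥ x) = x⁻¹ ℓ(x)` for
`x ≥ 1` (tail index `α = 1`), `ℓ` slowly varying, and `b_n` is a quantile of order `1 - 1/n` of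
their common law for every `n ≥ 1`. -/
structure HeavyTailedSteps {Ω : Type*} [MeasurableSpace Ω] (μ : Measure Ω)
    (Δ : ℕ → Ω → ℝ) (ℓ : ℝ → ℝ) (b : ℕ → ℝ) : Prop where
  indep : iIndepFun Δ μ
  ident : ∀ j, IdentDistrib (Δ j) (Δ 0) μ μ
  pos : ∀ j, ∀ᵐ ω ∂μ, 0 < Δ j ω
  mean_infinite : ∫⁻ ω, ENNReal.ofReal (Δ 0 ω) ∂μ = ⊤
  slow : SlowlyVarying ℓ
  tail : ∀ x : ℝ, 1 ≤ x → μ.real {ω | x ≤ Δ 0 ω} = x⁻¹ * ℓ x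
  quantile : ∀ n : ℕ, 1 ≤ n → IsQuantile μ (Δ 0) (1 - 1 / (n : ℝ)) (b n)

/-!
Write `ν` for the law of one step, `G x = ν [x, ∞)`, `m y = E [min Δ y]` and
`φ t = E [exp (-t Δ)]`. By independence and Tonelli, `E [1 / T_n] = ∫₀^∞ φ(t)^n dt`
(`lintegral_inv_renewal`), so everything is a matter of the asymptotics of this integral
(`tendsto_integral_laplace_pow`): with `a_n = n m(b_n)` it is equivalent to `1 / a_n`.

Substituting `t = s / a_n`, the integrand tends to `e^{-s}` (`tendsto_laplace_pow`): truncating the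
step at a multiple of `b_n` gives `1 - φ(s / a_n) ~ s / n`. This uses `n G(b_n) → 1`, which regular
variation of `G` gives for any choice of quantiles (`HeavyTailedSteps.tendsto_mul_lawTail`), and
`x G(x) = o(m(x))` (`tendsto_mul_lawTail_div_truncMean`), which makes `m` slowly varying and
`b_n = o(a_n)`.

For domination, `φ(t)^n ≤ exp (-n t m(1/t) / 2)`, and a Potter bound for `m`
(`exists_truncMean_sq_mul_le`) bounds the exponent from below by a multiple of `min s (√s)`
as long as `t` is small (`laplace_pow_le_inv_one_add_sq`). On the remaining range of `t` the
assumption `E [1 / T_k] < ∞` for some `k` makes `φ^k` integrable and the other `n - k` factors decay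
geometrically, while `a_n` grows at most quadratically.

Finally `ℓ* (y) = m(y) - m(1)` and `m → ∞` because the mean is infinite, so `m(b_n)` may be replaced
by `ℓ* (b_n)`; and `n ℓ(b_n) / b_n = n G(b_n) → 1` relates the two normalizations. Harmonic means
are `n / T_n` for steps `1 / V_j ≥ 1`, whose inverse is bounded, so that `k = 1` can be taken in the
moment condition.
-/

/-! ### Tail, truncated mean and Laplace transform of a law -/

/-- The left-closed tail `ν [x, ∞)`. -/
noncomputable def lawTail (ν : Measure ℝ) (x : ℝ) : ℝ := ν.real (Set.Ici x)

/-- The truncated mean `∫ min x y dν(x)`; the value at the truncation level is kept, so that this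
is an increasing function of `y` with slope `ν [y, ∞)`. -/
noncomputable def truncMean (ν : Measure ℝ) (y : ℝ) : ℝ := ∫ x, min x y ∂ν

/-- The Laplace transform `∫ exp (-t x) dν(x)`. -/
noncomputable def laplace (ν : Measure ℝ) (t : ℝ) : ℝ := ∫ x, Real.exp (-(t * x)) ∂ν

section Law

variable {ν : Measure ℝ}

lemma lawTail_nonneg (x : ℝ) : 0 ≤ lawTail ν x := measureReal_nonneg

lemma integral_indicator_Ici (c y : ℝ) :
    ∫ x, (Set.Ici y).indicator (fun _ => c) x ∂ν = c * lawTail ν y := by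
  rw [integral_indicator measurableSet_Ici, setIntegral_const, smul_eq_mul, mul_comm]
  rfl

lemma truncMean_zero (hpos : ∀ᵐ x ∂ν, 0 < x) : truncMean ν 0 = 0 := by
  unfold truncMean
  rw [integral_congr_ae (g := fun _ => 0)]
  · simp
  · filter_upwards [hpos] with x hx using min_eq_right hx.le

lemma laplace_nonneg (t : ℝ) : 0 ≤ laplace ν t := integral_nonneg fun _ => (Real.exp_pos _).le

variable [IsProbabilityMeasure ν]

lemma lawTail_anti : Antitone (lawTail ν) := fun _ _ h =>
  measureReal_mono (Set.Ici_subset_Ici.2 h)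

lemma integrable_min_const (hpos : ∀ᵐ x ∂ν, 0 < x) {y : ℝ} (hy : 0 ≤ y) :
    Integrable (fun x => min x y) ν := by
  refine Integrable.of_bound (by fun_prop) y ?_
  filter_upwards [hpos] with x hx
  rw [Real.norm_of_nonneg (le_min hx.le hy)]
  exact min_le_right _ _

lemma integrable_indicator_Ici (c y : ℝ) :
    Integrable ((Set.Ici y).indicator (fun _ => c)) ν :=
  (integrable_const c).indicator measurableSet_Ici

lemma truncMean_le_add (hpos : ∀ᵐ x ∂ν, 0 < x) {x y : ℝ} (hx : 0 ≤ x) (hxy : x ≤ y) :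
    truncMean ν y ≤ truncMean ν x + (y - x) * lawTail ν x := by
  unfold truncMean
  rw [← integral_indicator_Ici, ← integral_add (integrable_min_const hpos hx)
    (integrable_indicator_Ici _ _)]
  refine integral_mono (integrable_min_const hpos (hx.trans hxy))
    ((integrable_min_const hpos hx).add (integrable_indicator_Ici _ _)) fun z => ?_
  by_cases hz : x ≤ z
  · simp only [Set.indicator, Set.mem_Ici, hz, if_true, min_eq_right]
    linarith [min_le_right z y]
  · simp only [Set.indicator, Set.mem_Ici, hz, if_false]
    rw [min_eq_left (by linarith), min_eq_left (by linarith)]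
    simp

lemma add_le_truncMean (hpos : ∀ᵐ x ∂ν, 0 < x) {x y : ℝ} (hx : 0 ≤ x) (hxy : x ≤ y) :
    truncMean ν x + (y - x) * lawTail ν y ≤ truncMean ν y := by
  unfold truncMean
  rw [← integral_indicator_Ici, ← integral_add (integrable_min_const hpos hx)
    (integrable_indicator_Ici _ _)]
  refine integral_mono ((integrable_min_const hpos hx).add (integrable_indicator_Ici _ _))
    (integrable_min_const hpos (hx.trans hxy)) fun z => ?_
  by_cases hz : y ≤ z
  · simp only [Set.indicator, Set.mem_Ici, hz, if_true, min_eq_right]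
    linarith [min_le_right z x]
  · simp only [Set.indicator, Set.mem_Ici, hz, if_false]
    simpa using Or.inr hxy

lemma truncMean_mono (hpos : ∀ᵐ x ∂ν, 0 < x) {x y : ℝ} (hx : 0 ≤ x) (hxy : x ≤ y) :
    truncMean ν x ≤ truncMean ν y :=
  le_trans (by nlinarith [lawTail_nonneg (ν := ν) y]) (add_le_truncMean hpos hx hxy)

lemma mul_lawTail_le_truncMean (hpos : ∀ᵐ x ∂ν, 0 < x) {x : ℝ} (hx : 0 ≤ x) :
    x * lawTail ν x ≤ truncMean ν x := by
  simpa [truncMean_zero hpos] using add_le_truncMean hpos le_rfl hx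

/-- The truncated mean is the integral of the tail; differences of it from level `1` on are
the integrals `ℓ*`. -/
lemma truncMean_eq_integral (hpos : ∀ᵐ x ∂ν, 0 < x) {y : ℝ} (hy : 0 ≤ y) :
    truncMean ν y = ∫ t in (0 : ℝ)..y, lawTail ν t := by
  unfold truncMean
  rw [(integrable_min_const hpos hy).integral_eq_integral_meas_le
    (by filter_upwards [hpos] with x hx using le_min hx.le hy),
    intervalIntegral.integral_of_le hy, ← Set.Ioi_inter_Iic,
    ← setIntegral_indicator measurableSet_Iic]
  refine setIntegral_congr_fun measurableSet_Ioi fun t _ => ?_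
  by_cases ht : t ≤ y
  · simp [Set.indicator, ht, lawTail, Set.Ici]
  · simp [Set.indicator, ht]

lemma intervalIntegrable_lawTail (x y : ℝ) : IntervalIntegrable (lawTail ν) volume x y :=
  lawTail_anti.intervalIntegrable

lemma tendsto_truncMean (hpos : ∀ᵐ x ∂ν, 0 < x) (hinf : ∫⁻ x, ENNReal.ofReal x ∂ν = ⊤) :
    Tendsto (truncMean ν) atTop atTop := by
  have key : Tendsto (fun n : ℕ => truncMean ν n) atTop atTop := by
    have h1 : Tendsto (fun n : ℕ => ∫⁻ x, ENNReal.ofReal (min x n) ∂ν) atTop (𝓝 ⊤) := by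
      rw [← hinf]
      refine lintegral_tendsto_of_tendsto_of_monotone (fun n => by fun_prop) ?_ ?_
      · refine ae_of_all _ fun x i j hij => ?_
        exact ENNReal.ofReal_le_ofReal (min_le_min_left _ (by exact_mod_cast hij))
      · refine ae_of_all _ fun x => ?_
        refine tendsto_const_nhds.congr' ?_
        obtain ⟨N, hN⟩ := exists_nat_ge x
        filter_upwards [eventually_ge_atTop N] with n hn
        rw [min_eq_left (hN.trans (by exact_mod_cast hn))]
    rw [← ENNReal.tendsto_ofReal_nhds_top]
    refine h1.congr fun n => ?_
    rw [truncMean, ofReal_integral_eq_lintegral_ofReal (integrable_min_const hpos n.cast_nonneg)]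
    filter_upwards [hpos] with x hx using le_min hx.le n.cast_nonneg
  refine tendsto_atTop.2 fun C => ?_
  obtain ⟨n, hn⟩ := (key.eventually_ge_atTop C).exists
  filter_upwards [eventually_ge_atTop (n : ℝ)] with y hy
  exact hn.trans (truncMean_mono hpos n.cast_nonneg hy)

lemma integrable_exp_neg_mul (hpos : ∀ᵐ x ∂ν, 0 < x) {t : ℝ} (ht : 0 ≤ t) :
    Integrable (fun x => Real.exp (-(t * x))) ν := by
  refine Integrable.of_bound (by fun_prop) 1 ?_
  filter_upwards [hpos] with x hx
  rw [Real.norm_of_nonneg (Real.exp_pos _).le, Real.exp_le_one_iff]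
  nlinarith

lemma laplace_anti (hpos : ∀ᵐ x ∂ν, 0 < x) {s t : ℝ} (hs : 0 ≤ s) (hst : s ≤ t) :
    laplace ν t ≤ laplace ν s := by
  refine integral_mono_ae (integrable_exp_neg_mul hpos (hs.trans hst))
    (integrable_exp_neg_mul hpos hs) ?_
  filter_upwards [hpos] with x hx
  exact Real.exp_le_exp.2 (by nlinarith)

lemma laplace_le_one (hpos : ∀ᵐ x ∂ν, 0 < x) {t : ℝ} (ht : 0 ≤ t) : laplace ν t ≤ 1 := by
  simpa [laplace] using laplace_anti hpos le_rfl ht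

lemma measurable_laplace : Measurable (laplace ν) := by
  refine (StronglyMeasurable.integral_prod_right
    (f := fun t x : ℝ => Real.exp (-(t * x))) ?_).measurable
  exact (Measurable.stronglyMeasurable (by unfold Function.uncurry; fun_prop))

lemma exp_neg_le_quadratic {u : ℝ} (hu : 0 ≤ u) : Real.exp (-u) ≤ 1 - u + u ^ 2 / 2 := by
  have h := Real.quadratic_le_exp_of_nonneg hu
  have h0 : 0 < 1 - u + u ^ 2 / 2 := by nlinarith [sq_nonneg (u - 1)]
  rw [Real.exp_neg, inv_le_comm₀ (Real.exp_pos _) h0]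
  refine le_trans ?_ h
  rw [inv_le_iff_one_le_mul₀ h0]
  nlinarith [sq_nonneg (u ^ 2)]

/-- Small arguments: replacing the variable by its truncation at `y` and expanding to second order,
the square being at most `y` times the truncated variable. -/
lemma laplace_le (hpos : ∀ᵐ x ∂ν, 0 < x) {t y : ℝ} (ht : 0 ≤ t) (hy : 0 ≤ y) :
    laplace ν t ≤ 1 - (t - t ^ 2 * y / 2) * truncMean ν y := by
  have hi := (integrable_min_const hpos hy).const_mul (t - t ^ 2 * y / 2)
  have e : 1 - (t - t ^ 2 * y / 2) * truncMean ν y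
      = ∫ x, (1 - (t - t ^ 2 * y / 2) * min x y) ∂ν := by
    rw [integral_sub (integrable_const _) hi, integral_const_mul]; simp [truncMean]
  rw [e]
  refine integral_mono_ae (integrable_exp_neg_mul hpos ht) ((integrable_const _).sub hi) ?_
  filter_upwards [hpos] with x hx
  have h0 : 0 ≤ min x y := le_min hx.le hy
  have h1 : Real.exp (-(t * x)) ≤ Real.exp (-(t * min x y)) :=
    Real.exp_le_exp.2 (by nlinarith [min_le_left x y])
  have h2 := exp_neg_le_quadratic (mul_nonneg ht h0)
  have h3 : t ^ 2 * (min x y * min x y) ≤ t ^ 2 * (y * min x y) := by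
    gcongr; exact min_le_right x y
  show Real.exp (-(t * x)) ≤ 1 - (t - t ^ 2 * y / 2) * min x y
  nlinarith

/-- The counterpart of `laplace_le`: below `y` the exponential is expanded to first order, above `y`
only its positivity is used. -/
lemma le_laplace (hpos : ∀ᵐ x ∂ν, 0 < x) {t y : ℝ} (ht : 0 ≤ t) (hy : 0 ≤ y) :
    1 - t * truncMean ν y - lawTail ν y ≤ laplace ν t := by
  have hi := (integrable_min_const hpos hy).const_mul t
  have hj := integrable_indicator_Ici (ν := ν) 1 y
  have e : 1 - t * truncMean ν y - lawTail ν y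
      = ∫ x, (1 - t * min x y - (Set.Ici y).indicator (fun _ => 1) x) ∂ν := by
    rw [integral_sub (f := fun x => 1 - t * min x y) ((integrable_const _).sub hi) hj,
      integral_sub (integrable_const _) hi,
      integral_const_mul, integral_indicator_Ici]
    simp [truncMean]
  rw [e]
  refine integral_mono_ae (((integrable_const _).sub hi).sub hj) (integrable_exp_neg_mul hpos ht) ?_
  filter_upwards [hpos] with x hx
  by_cases hxy : y ≤ x
  · simp only [Set.indicator, Set.mem_Ici, hxy, if_true, min_eq_right]
    nlinarith [Real.exp_pos (-(t * x)), mul_nonneg ht hy]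
  · simp only [Set.indicator, Set.mem_Ici, hxy, if_false]
    rw [min_eq_left (by linarith)]
    linarith [Real.add_one_le_exp (-(t * x))]

/-- The choice `y = 1 / t` in `laplace_le`, which makes the quadratic term half the linear one. -/
lemma laplace_pow_le (hpos : ∀ᵐ x ∂ν, 0 < x) {t : ℝ} (ht : 0 < t) (n : ℕ) :
    laplace ν t ^ n ≤ Real.exp (-(n * (t * truncMean ν t⁻¹) / 2)) := by
  have h := laplace_le hpos ht.le (inv_pos.2 ht).le
  have e : (t - t ^ 2 * t⁻¹ / 2) = t / 2 := by field_simp; ring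
  rw [e] at h
  have h2 : laplace ν t ≤ Real.exp (-(t * truncMean ν t⁻¹ / 2)) := by
    linarith [Real.add_one_le_exp (-(t * truncMean ν t⁻¹ / 2))]
  refine (pow_le_pow_left₀ (laplace_nonneg t) h2 n).trans_eq ?_
  rw [← Real.exp_nat_mul]
  congr 1; ring

lemma laplace_lt_one (hpos : ∀ᵐ x ∂ν, 0 < x) (hG : ∀ x, 0 < lawTail ν x) {t : ℝ} (ht : 0 < t) :
    laplace ν t < 1 := by
  have h := laplace_pow_le hpos ht 1
  rw [pow_one] at h
  refine h.trans_lt (Real.exp_lt_one_iff.2 ?_)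
  have := (mul_pos (inv_pos.2 ht) (hG t⁻¹)).trans_le
    (mul_lawTail_le_truncMean hpos (inv_pos.2 ht).le)
  have := mul_pos ht this
  push_cast
  linarith

/-! ### Regularly varying tails of index one -/

/-- The truncated mean dominates `x ν [x, ∞)`: each of the last `k` dyadic shells below `x`
contributes about `x ν [x, ∞) / 2`. -/
lemma eventually_mul_lawTail_le (hpos : ∀ᵐ x ∂ν, 0 < x) (hG : ∀ x, 0 < lawTail ν x)
    (hrv : ∀ c : ℝ, 0 < c → Tendsto (fun x => lawTail ν (c * x) / lawTail ν x) atTop (𝓝 c⁻¹))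
    (k : ℕ) : ∀ᶠ x in atTop, k / 4 * (x * lawTail ν x) ≤ truncMean ν x := by
  induction k with
  | zero =>
    filter_upwards [eventually_ge_atTop 0] with x hx
    have := mul_lawTail_le_truncMean hpos hx
    have := mul_nonneg hx (hG x).le
    push_cast; linarith
  | succ k ih =>
    have h2 : Tendsto (fun x : ℝ => 1 / 2 * x) atTop atTop :=
      tendsto_id.const_mul_atTop (by norm_num)
    -- `G (x / 2)` is about `2 G x`; a relative loss of `1 / (k + 1)` is absorbed by the
    -- contribution `1 / 2` of the new shell, as the induction claims only `1 / 4` more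
    have hr := (hrv (1 / 2) (by norm_num)).eventually_const_lt
      (u := 2 * (1 - 1 / (k + 1 : ℝ))) (by
        have : 0 < 1 / (k + 1 : ℝ) := by positivity
        norm_num; linarith)
    filter_upwards [h2.eventually ih, hr, eventually_gt_atTop 0] with x h1 h3 hx
    have h4 := add_le_truncMean hpos (x := 1 / 2 * x) (y := x) (by linarith) (by linarith)
    rw [lt_div_iff₀ (hG x)] at h3
    set g := lawTail ν x
    set g2 := lawTail ν (1 / 2 * x)
    have hk : (0 : ℝ) ≤ k := k.cast_nonneg
    have h5 : (k : ℝ) * (1 - 1 / (k + 1 : ℝ)) ≥ k - 1 := by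
      have : (k : ℝ) * (1 - 1 / (k + 1 : ℝ)) = k - 1 + 1 / (k + 1) := by field_simp; ring
      have : 0 < 1 / (k + 1 : ℝ) := by positivity
      linarith
    have hgx : 0 < x * g := mul_pos hx (hG x)
    have h6 : (k : ℝ) * x * (2 * (1 - 1 / (k + 1 : ℝ)) * g) ≤ k * x * g2 := by gcongr
    have h7 : ((k : ℝ) - 1) * (x * g) ≤ k * (1 - 1 / (k + 1 : ℝ)) * (x * g) := by gcongr
    push_cast
    linarith

lemma tendsto_mul_lawTail_div_truncMean (hpos : ∀ᵐ x ∂ν, 0 < x) (hG : ∀ x, 0 < lawTail ν x)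
    (hrv : ∀ c : ℝ, 0 < c → Tendsto (fun x => lawTail ν (c * x) / lawTail ν x) atTop (𝓝 c⁻¹)) :
    Tendsto (fun x => truncMean ν x / (x * lawTail ν x)) atTop atTop := by
  refine tendsto_atTop.2 fun C => ?_
  obtain ⟨k, hk⟩ := exists_nat_ge (4 * C)
  filter_upwards [eventually_mul_lawTail_le hpos hG hrv k, eventually_gt_atTop 0] with x h hx
  have hgx : 0 < x * lawTail ν x := mul_pos hx (hG x)
  rw [le_div_iff₀ hgx]
  exact le_trans (by gcongr; linarith) h

/-- A Potter bound: beyond some level the truncated mean grows at most like a square root. -/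
lemma exists_truncMean_sq_mul_le (hpos : ∀ᵐ x ∂ν, 0 < x) (hG : ∀ x, 0 < lawTail ν x)
    (hrv : ∀ c : ℝ, 0 < c → Tendsto (fun x => lawTail ν (c * x) / lawTail ν x) atTop (𝓝 c⁻¹)) :
    ∃ X : ℝ, 1 ≤ X ∧ ∀ x y, X ≤ x → x ≤ y →
      truncMean ν y ^ 2 * x ≤ 4 * truncMean ν x ^ 2 * y := by
  -- with `x G x ≤ m x / 4`, doubling the level multiplies `m` by at most `5 / 4 ≤ √2`
  obtain ⟨X₀, hX₀⟩ := eventually_atTop.1 (eventually_mul_lawTail_le hpos hG hrv 16)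
  refine ⟨max X₀ 1, le_max_right _ _, ?_⟩
  have hm : ∀ {x : ℝ}, 0 ≤ x → 0 ≤ truncMean ν x := fun {x} hx =>
    (mul_nonneg hx (hG x).le).trans (mul_lawTail_le_truncMean hpos hx)
  have dbl : ∀ x, max X₀ 1 ≤ x → truncMean ν (2 * x) ^ 2 ≤ 2 * truncMean ν x ^ 2 := by
    intro x hx
    have hx1 : 1 ≤ x := (le_max_right _ _).trans hx
    have h1 := hX₀ x ((le_max_left _ _).trans hx)
    have h2 := truncMean_le_add hpos (x := x) (y := 2 * x) (by linarith) (by linarith)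
    have h0 := hm (x := 2 * x) (by linarith)
    have h3 : truncMean ν (2 * x) ≤ 5 / 4 * truncMean ν x := by push_cast at h1; linarith
    have := pow_le_pow_left₀ h0 h3 2
    nlinarith [sq_nonneg (truncMean ν x)]
  have key : ∀ k : ℕ, ∀ x y, max X₀ 1 ≤ x → x ≤ y → y ≤ 2 ^ k * x →
      truncMean ν y ^ 2 * x ≤ 4 * truncMean ν x ^ 2 * y := by
    intro k
    induction k with
    | zero =>
      intro x y hx hxy hy
      have : y = x := by linarith
      subst this
      have : 0 < y := by linarith [(le_max_right X₀ 1).trans hx]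
      nlinarith [mul_nonneg (sq_nonneg (truncMean ν y)) this.le]
    | succ k ih =>
      intro x y hx hxy hy
      have hx0 : 0 < x := by linarith [(le_max_right X₀ 1).trans hx]
      rcases le_total (2 * x) y with h | h
      · have h1 := ih x (y / 2) hx (by linarith) (by rw [pow_succ] at hy; linarith)
        have h2 := dbl (y / 2) (by linarith)
        rw [mul_div_cancel₀ y (two_ne_zero)] at h2
        have := mul_le_mul_of_nonneg_right h2 hx0.le
        linarith
      · have h1 := pow_le_pow_left₀ (hm (by linarith)) (truncMean_mono hpos (by linarith) h) 2
        have h2 := h1.trans (dbl x hx)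
        have h3 := mul_le_mul_of_nonneg_right h2 hx0.le
        have h4 := mul_le_mul_of_nonneg_left hxy (sq_nonneg (truncMean ν x))
        nlinarith [mul_nonneg (sq_nonneg (truncMean ν x)) hx0.le]
  intro x y hx hxy
  have hx0 : 0 < x := by linarith [(le_max_right X₀ 1).trans hx]
  obtain ⟨k, hk⟩ := pow_unbounded_of_one_lt (y / x) (one_lt_two (α := ℝ))
  exact key k x y hx hxy ((div_lt_iff₀ hx0).1 hk).le

end Law

/-! ### Asymptotics of the integrated powers of the Laplace transform -/

section LaplacePowers

variable {ν : Measure ℝ} [IsProbabilityMeasure ν]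

lemma tendsto_natCast_mul_truncMean_div (hpos : ∀ᵐ x ∂ν, 0 < x) (hG : ∀ x, 0 < lawTail ν x)
    (hrv : ∀ c : ℝ, 0 < c → Tendsto (fun x => lawTail ν (c * x) / lawTail ν x) atTop (𝓝 c⁻¹))
    {b : ℕ → ℝ} (hb : Tendsto b atTop atTop)
    (hn : Tendsto (fun n : ℕ => n * lawTail ν (b n)) atTop (𝓝 1)) :
    Tendsto (fun n : ℕ => n * truncMean ν (b n) / b n) atTop atTop := by
  refine (((tendsto_mul_lawTail_div_truncMean hpos hG hrv).comp hb).atTop_mul_pos one_pos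
    hn).congr fun n => ?_
  have := (hG (b n)).ne'
  simp only [Function.comp]
  field_simp

lemma truncMean_pos (hpos : ∀ᵐ x ∂ν, 0 < x) (hG : ∀ x, 0 < lawTail ν x) {x : ℝ} (hx : 0 < x) :
    0 < truncMean ν x :=
  (mul_pos hx (hG x)).trans_le (mul_lawTail_le_truncMean hpos hx.le)

/-- The truncated mean is slowly varying, stated along a sequence of levels. -/
lemma tendsto_truncMean_mul_div (hpos : ∀ᵐ x ∂ν, 0 < x) (hG : ∀ x, 0 < lawTail ν x)
    (hrv : ∀ c : ℝ, 0 < c → Tendsto (fun x => lawTail ν (c * x) / lawTail ν x) atTop (𝓝 c⁻¹))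
    {b : ℕ → ℝ} (hb : Tendsto b atTop atTop) {K : ℝ} (hK : 1 ≤ K) :
    Tendsto (fun n => truncMean ν (K * b n) / truncMean ν (b n)) atTop (𝓝 1) := by
  have h0 := ((tendsto_mul_lawTail_div_truncMean hpos hG hrv).comp hb).inv_tendsto_atTop
  have h1 : Tendsto (fun n => 1 + (K - 1) *
      ((fun x => truncMean ν x / (x * lawTail ν x)) ∘ b)⁻¹ n) atTop (𝓝 1) := by
    simpa using (h0.const_mul (K - 1)).const_add 1
  refine tendsto_of_tendsto_of_tendsto_of_le_of_le' tendsto_const_nhds h1 ?_ ?_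
  · filter_upwards [hb.eventually_gt_atTop 0] with n hn
    rw [one_le_div (truncMean_pos hpos hG hn)]
    exact truncMean_mono hpos hn.le (by nlinarith)
  · filter_upwards [hb.eventually_gt_atTop 0] with n hn
    have hm := truncMean_pos hpos hG hn
    rw [div_le_iff₀ hm]
    have h := truncMean_le_add hpos hn.le (show b n ≤ K * b n by nlinarith)
    have e : (1 + (K - 1) * ((fun x => truncMean ν x / (x * lawTail ν x)) ∘ b)⁻¹ n)
        * truncMean ν (b n) = truncMean ν (b n) + (K * b n - b n) * lawTail ν (b n) := by
      simp only [Pi.inv_apply, Function.comp, inv_div]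
      field_simp
    rw [e]; exact h

/-- With `s / (n m(b_n))` as argument, the `n`-th power of the Laplace transform tends to `e^{-s}`.
The variable is truncated at `b_n` for the upper bound and at a large multiple `K b_n` for the lower
bound; exceeding `K b_n` has probability about `1 / (K n)`. -/
lemma tendsto_laplace_pow (hpos : ∀ᵐ x ∂ν, 0 < x) (hG : ∀ x, 0 < lawTail ν x)
    (hrv : ∀ c : ℝ, 0 < c → Tendsto (fun x => lawTail ν (c * x) / lawTail ν x) atTop (𝓝 c⁻¹))
    {b : ℕ → ℝ} (hb : Tendsto b atTop atTop)
    (hn : Tendsto (fun n : ℕ => n * lawTail ν (b n)) atTop (𝓝 1)) {s : ℝ} (hs : 0 ≤ s) :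
    Tendsto (fun n : ℕ => laplace ν ((n * truncMean ν (b n))⁻¹ * s) ^ n) atTop
      (𝓝 (Real.exp (-s))) := by
  suffices h : Tendsto (fun n : ℕ => n * (1 - laplace ν ((n * truncMean ν (b n))⁻¹ * s))) atTop
      (𝓝 s) by
    refine (Real.tendsto_one_add_pow_exp_of_tendsto
      (g := fun n => laplace ν ((n * truncMean ν (b n))⁻¹ * s) - 1) ?_).congr fun n => by ring
    exact h.neg.congr fun n => by ring
  refine tendsto_order.2 ⟨fun c hc => ?_, fun c hc => ?_⟩
  · have h1 : Tendsto (fun n : ℕ => s - s ^ 2 / 2 * (n * truncMean ν (b n) / b n)⁻¹) atTop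
        (𝓝 s) := by
      simpa using ((tendsto_natCast_mul_truncMean_div hpos hG hrv hb hn).inv_tendsto_atTop.const_mul
        (s ^ 2 / 2)).const_sub s
    filter_upwards [h1.eventually_const_lt hc, hb.eventually_gt_atTop 0, eventually_gt_atTop 0]
      with n h2 hbn hn0
    have hm := truncMean_pos hpos hG hbn
    have hn1 : (0 : ℝ) < n := by exact_mod_cast hn0
    have h3 := laplace_le hpos (t := (n * truncMean ν (b n))⁻¹ * s) (by positivity) hbn.le
    refine h2.trans_le ?_
    have e : s - s ^ 2 / 2 * (n * truncMean ν (b n) / b n)⁻¹ =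
        n * (((n * truncMean ν (b n))⁻¹ * s - ((n * truncMean ν (b n))⁻¹ * s) ^ 2 * b n / 2) *
          truncMean ν (b n)) := by
      field_simp
    rw [e]
    gcongr
    linarith
  · obtain ⟨K, hK⟩ := exists_nat_gt (max 1 (1 / (c - s)))
    have hK1 : (1 : ℝ) ≤ K := ((le_max_left _ _).trans_lt hK).le
    have hK0 : (0 : ℝ) < K := by linarith
    have hKc : s + (K : ℝ)⁻¹ < c := by
      have h := (le_max_right _ _).trans_lt hK
      rw [one_div, inv_lt_comm₀ (by linarith) hK0] at h
      linarith
    have h1 : Tendsto (fun n : ℕ => s * (truncMean ν (K * b n) / truncMean ν (b n)) +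
        n * lawTail ν (b n) * (lawTail ν (K * b n) / lawTail ν (b n))) atTop
        (𝓝 (s + (K : ℝ)⁻¹)) := by
      simpa using ((tendsto_truncMean_mul_div hpos hG hrv hb hK1).const_mul s).add
        (hn.mul ((hrv K hK0).comp hb))
    filter_upwards [h1.eventually_lt_const hKc, hb.eventually_gt_atTop 0, eventually_gt_atTop 0]
      with n h2 hbn hn0
    have hm := truncMean_pos hpos hG hbn
    have hg := hG (b n)
    have hn1 : (0 : ℝ) < n := by exact_mod_cast hn0
    have h3 := le_laplace hpos (t := (n * truncMean ν (b n))⁻¹ * s) (y := K * b n)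
      (by positivity) (by positivity)
    refine lt_of_le_of_lt ?_ h2
    have e : s * (truncMean ν (K * b n) / truncMean ν (b n)) +
        n * lawTail ν (b n) * (lawTail ν (K * b n) / lawTail ν (b n)) =
        n * ((n * truncMean ν (b n))⁻¹ * s * truncMean ν (K * b n) + lawTail ν (K * b n)) := by
      field_simp
    rw [e]
    gcongr
    linarith

/-- An integrable bound for the rescaled powers, uniform in `n`, on the range `s ≤ a / X` where the
Potter bound applies. Below `s = a / b` the exponent is at least `s / 2`, above it at least
`√s / 4`; the constant is `1 + 4! * 4 ^ 4`. -/
lemma laplace_pow_le_inv_one_add_sq (hpos : ∀ᵐ x ∂ν, 0 < x) (hG : ∀ x, 0 < lawTail ν x)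
    {X : ℝ} (hX : 1 ≤ X) (hP : ∀ x y, X ≤ x → x ≤ y →
      truncMean ν y ^ 2 * x ≤ 4 * truncMean ν x ^ 2 * y)
    {n : ℕ} {b : ℝ} (hb : 0 < b) (hnb : b ≤ n * truncMean ν b) {s : ℝ} (hs : 0 < s)
    (hsX : (n * truncMean ν b)⁻¹ * s ≤ X⁻¹) :
    laplace ν ((n * truncMean ν b)⁻¹ * s) ^ n ≤ 6145 * (1 + s ^ 2)⁻¹ := by
  have hm := truncMean_pos hpos hG hb
  set a := n * truncMean ν b with ha
  have ha0 : 0 < a := hb.trans_le hnb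
  set t := a⁻¹ * s with ht
  have ht0 : 0 < t := by positivity
  have hat : n * truncMean ν b * t = s := by rw [← ha, ht]; field_simp
  set x := t⁻¹ with hx
  have hx0 : 0 < x := inv_pos.2 ht0
  have hxX : X ≤ x := by rw [hx, le_inv_comm₀ (by linarith) ht0]; exact hsX
  have htx : t * x = 1 := mul_inv_cancel₀ ht0.ne'
  refine (laplace_pow_le hpos ht0 n).trans ?_
  rw [← hx]
  have hmx := truncMean_pos hpos hG hx0
  set u := n * (t * truncMean ν x) / 2 with hu
  have hu0 : 0 ≤ u := by positivity
  have hs2 : s ^ 2 ≤ 6144 * Real.exp u := by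
    -- `1 / t` above or below the quantile level; only the second case needs the Potter bound
    rcases le_total b x with h | h
    · have h1 : s / 2 ≤ u := by
        rw [hu, ← hat]
        have := truncMean_mono hpos hb.le h
        have := mul_le_mul_of_nonneg_left this (mul_nonneg n.cast_nonneg ht0.le : 0 ≤ (n : ℝ) * t)
        linarith
      have h2 := Real.quadratic_le_exp_of_nonneg hu0
      nlinarith
    · have h1 := hP x b hxX h
      have h3 : s ≤ 16 * u ^ 2 := by
        have h4 : a ^ 2 * x ≤ 4 * (n * truncMean ν x) ^ 2 * b := by
          have := mul_le_mul_of_nonneg_left h1 (sq_nonneg (n : ℝ))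
          rw [ha]; linarith
        have h5 : a ^ 2 * t ≤ 4 * (n * (t * truncMean ν x)) ^ 2 * b := by
          have := mul_le_mul_of_nonneg_left h4 (sq_nonneg t)
          have e : t ^ 2 * (a ^ 2 * x) = a ^ 2 * t * (t * x) := by ring
          rw [e, htx] at this
          linarith
        have h6 : a * s ≤ 16 * u ^ 2 * b := by
          have e1 : a ^ 2 * t = a * s := by rw [← hat, ← ha]; ring
          rw [← e1, hu]; linarith
        have h7 : a * s ≤ a * (16 * u ^ 2) := by
          have := mul_le_mul_of_nonneg_left hnb (by positivity : 0 ≤ 16 * u ^ 2)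
          linarith
        exact le_of_mul_le_mul_left h7 ha0
      have h2 := Real.pow_div_factorial_le_exp u hu0 4
      have h8 : s ^ 2 ≤ (16 * u ^ 2) ^ 2 := pow_le_pow_left₀ hs.le h3 2
      have e : ((Nat.factorial 4 : ℕ) : ℝ) = 24 := by norm_num [Nat.factorial]
      rw [e] at h2
      nlinarith
  rw [Real.exp_neg, ← div_eq_mul_inv, le_div_iff₀ (by positivity), inv_mul_le_iff₀ (Real.exp_pos _)]
  have := Real.one_le_exp hu0
  linarith

/-- The scale `n m(b_n)` is `O(n ^ 2)`: the Potter bound gives `m(b) = O(√b)`, and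
`b / (2 n) ≤ b G(b) ≤ m(b)` turns this into `m(b) = O(n)`. -/
lemma exists_natCast_mul_truncMean_le (hpos : ∀ᵐ x ∂ν, 0 < x)
    {X : ℝ} (hX : 1 ≤ X) (hP : ∀ x y, X ≤ x → x ≤ y →
      truncMean ν y ^ 2 * x ≤ 4 * truncMean ν x ^ 2 * y)
    (hG : ∀ x, 0 < lawTail ν x) {b : ℕ → ℝ} (hb : Tendsto b atTop atTop)
    (hn : Tendsto (fun n : ℕ => n * lawTail ν (b n)) atTop (𝓝 1)) :
    ∃ C : ℝ, ∀ᶠ n : ℕ in atTop, n * truncMean ν (b n) ≤ C * n ^ 2 := by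
  set M := 4 * truncMean ν X ^ 2 / X with hM
  have hX0 : 0 < X := by linarith
  have hM0 : 0 ≤ M := by positivity
  refine ⟨2 * M, ?_⟩
  filter_upwards [hb.eventually_ge_atTop X, hn.eventually_const_lt (u := 1 / 2) (by norm_num),
    eventually_gt_atTop 0] with n h1 h2 hn0
  have hn1 : (0 : ℝ) < n := by exact_mod_cast hn0
  have hb0 : 0 < b n := by linarith
  have hm := truncMean_pos hpos hG hb0
  have h3 := mul_lawTail_le_truncMean hpos hb0.le
  have h4 : truncMean ν (b n) ^ 2 ≤ M * b n := by
    rw [hM, div_mul_eq_mul_div, le_div_iff₀ hX0]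
    exact hP X (b n) le_rfl h1
  have h5 : b n ≤ 2 * n * truncMean ν (b n) := by
    have := mul_le_mul_of_nonneg_left h3 hn1.le
    have := mul_le_mul_of_nonneg_left h2.le hb0.le
    linarith
  have h6 : truncMean ν (b n) * truncMean ν (b n) ≤ 2 * M * n * truncMean ν (b n) := by
    have := mul_le_mul_of_nonneg_left h5 hM0
    linarith
  have h7 := le_of_mul_le_mul_right h6 hm
  nlinarith

/-- Dominated convergence after the substitution `t = s / (n m(b_n))` handles `t ≤ 1 / X`; the rest
is exponentially small because `n m(b_n)` grows at most quadratically. -/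
theorem tendsto_integral_laplace_pow (hpos : ∀ᵐ x ∂ν, 0 < x) (hG : ∀ x, 0 < lawTail ν x)
    (hrv : ∀ c : ℝ, 0 < c → Tendsto (fun x => lawTail ν (c * x) / lawTail ν x) atTop (𝓝 c⁻¹))
    {b : ℕ → ℝ} (hb : Tendsto b atTop atTop)
    (hn : Tendsto (fun n : ℕ => n * lawTail ν (b n)) atTop (𝓝 1)) {k : ℕ}
    (hk : IntegrableOn (fun t => laplace ν t ^ k) (Set.Ioi 0)) :
    Tendsto (fun n : ℕ => n * truncMean ν (b n) * ∫ t in Set.Ioi 0, laplace ν t ^ n) atTop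
      (𝓝 1) := by
  obtain ⟨X, hX, hP⟩ := exists_truncMean_sq_mul_le hpos hG hrv
  obtain ⟨C, hC⟩ := exists_natCast_mul_truncMean_le hpos hX hP hG hb hn
  have hX0 : 0 < X⁻¹ := by positivity
  have hmeas : ∀ n : ℕ, Measurable fun t => laplace ν t ^ n := fun n =>
    measurable_laplace.pow_const n
  have hle : ∀ (j : ℕ) {t : ℝ}, 0 < t → laplace ν t ^ j ≤ 1 := fun j t ht =>
    pow_le_one₀ (laplace_nonneg t) (laplace_le_one hpos ht.le)
  have hint : ∀ n, k ≤ n → IntegrableOn (fun t => laplace ν t ^ n) (Set.Ioi 0) := by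
    intro n hkn
    refine Integrable.mono hk (hmeas n).aestronglyMeasurable ?_
    filter_upwards [ae_restrict_mem measurableSet_Ioi] with t ht
    rw [Real.norm_of_nonneg (pow_nonneg (laplace_nonneg t) _),
      Real.norm_of_nonneg (pow_nonneg (laplace_nonneg t) _)]
    exact pow_le_pow_of_le_one (laplace_nonneg t) (laplace_le_one hpos (le_of_lt ht)) hkn
  set a : ℕ → ℝ := fun n => n * truncMean ν (b n) with ha
  have hratio := tendsto_natCast_mul_truncMean_div hpos hG hrv hb hn
  have hab : ∀ᶠ n in atTop, b n ≤ a n := by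
    filter_upwards [hratio.eventually_ge_atTop 1, hb.eventually_gt_atTop 0] with n h1 h2
    rwa [one_le_div h2] at h1
  have haT : Tendsto a atTop atTop := tendsto_atTop_mono' _ hab hb
  have hmain : Tendsto (fun n => ∫ s in Set.Ioi (0 : ℝ),
      (Set.Iic X⁻¹).indicator (fun t => laplace ν t ^ n) ((a n)⁻¹ * s)) atTop (𝓝 1) := by
    rw [← integral_exp_neg_Ioi_zero]
    refine tendsto_integral_filter_of_dominated_convergence (fun s => 6145 * (1 + s ^ 2)⁻¹)
      ?_ ?_ (integrable_inv_one_add_sq.const_mul _).integrableOn ?_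
    · refine Eventually.of_forall fun n => ?_
      exact (((hmeas n).indicator measurableSet_Iic).comp
        (measurable_const_mul (a n)⁻¹)).aestronglyMeasurable
    · filter_upwards [hab, hb.eventually_gt_atTop 0] with n h1 h2
      filter_upwards [ae_restrict_mem measurableSet_Ioi] with s hs
      by_cases hsX : (a n)⁻¹ * s ≤ X⁻¹
      · rw [Set.indicator_of_mem (Set.mem_Iic.2 hsX),
          Real.norm_of_nonneg (pow_nonneg (laplace_nonneg _) _)]
        exact laplace_pow_le_inv_one_add_sq hpos hG hX hP h2 h1 hs hsX
      · rw [Set.indicator_of_notMem (by simpa using hsX), norm_zero]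
        positivity
    · filter_upwards [ae_restrict_mem measurableSet_Ioi] with s hs
      refine (tendsto_laplace_pow hpos hG hrv hb hn (le_of_lt hs)).congr' ?_
      have h0 : Tendsto (fun n => (a n)⁻¹ * s) atTop (𝓝 0) := by
        simpa using haT.inv_tendsto_atTop.mul_const s
      filter_upwards [h0.eventually_le_const hX0] with n h
      rw [Set.indicator_of_mem (Set.mem_Iic.2 h)]
  have htail : Tendsto (fun n => a n * ∫ t in Set.Ioi X⁻¹, laplace ν t ^ n) atTop (𝓝 0) := by
    set r := laplace ν X⁻¹ with hr
    have hr1 : r < 1 := laplace_lt_one hpos hG hX0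
    have hr0 : 0 ≤ r := laplace_nonneg _
    set J := ∫ t in Set.Ioi X⁻¹, laplace ν t ^ k with hJ
    have hJ0 : 0 ≤ J := integral_nonneg fun t => pow_nonneg (laplace_nonneg _) _
    have hsub : Set.Ioi X⁻¹ ⊆ Set.Ioi (0 : ℝ) := Set.Ioi_subset_Ioi hX0.le
    -- comparison with `n ^ 2 * r ^ (n - k)`, written with an index shifted by `k`
    have hpow : Tendsto (fun n : ℕ => C * ((n + k : ℕ) : ℝ) ^ 2 * (r ^ n * J)) atTop (𝓝 0) := by
      have h (j : ℕ) := tendsto_pow_const_mul_const_pow_of_abs_lt_one j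
        (show |r| < 1 by rwa [abs_of_nonneg hr0])
      have := (((h 2).add ((h 1).const_mul (2 * k : ℝ))).add
        ((h 0).const_mul ((k : ℝ) ^ 2))).const_mul (C * J)
      simp only [mul_zero, add_zero] at this
      refine this.congr fun n => ?_
      push_cast; ring
    refine (tendsto_add_atTop_iff_nat k).1 ?_
    refine squeeze_zero' ?_ ?_ hpow
    · filter_upwards [(tendsto_add_atTop_nat k).eventually
        (haT.eventually_ge_atTop 0)] with n h
      exact mul_nonneg h (integral_nonneg fun t => pow_nonneg (laplace_nonneg _) _)
    · filter_upwards [(tendsto_add_atTop_nat k).eventually (haT.eventually_ge_atTop 0),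
        (tendsto_add_atTop_nat k).eventually hC] with n h0 h
      have h1 : ∫ t in Set.Ioi X⁻¹, laplace ν t ^ (n + k) ≤ r ^ n * J := by
        rw [hJ, ← integral_const_mul]
        refine setIntegral_mono_on ((hint (n + k) (by omega)).mono_set hsub)
          ((hk.mono_set hsub).const_mul _) measurableSet_Ioi fun t ht => ?_
        rw [pow_add]
        have := laplace_nonneg (ν := ν) t
        gcongr
        exact laplace_anti hpos hX0.le (le_of_lt ht)
      calc a (n + k) * _ ≤ a (n + k) * (r ^ n * J) := by gcongr
        _ ≤ _ := by gcongr
  have hsum := hmain.add htail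
  rw [add_zero] at hsum
  refine hsum.congr' ?_
  filter_upwards [haT.eventually_gt_atTop 0, eventually_ge_atTop k] with n h0 hkn
  rw [integral_comp_mul_left_Ioi _ _ (inv_pos.2 h0), mul_zero, inv_inv, smul_eq_mul,
    setIntegral_indicator measurableSet_Iic, Set.Ioi_inter_Iic, ← mul_add,
    ← setIntegral_union (Set.Ioc_disjoint_Ioi le_rfl) measurableSet_Ioi
      ((hint n hkn).mono_set Set.Ioc_subset_Ioi_self)
      ((hint n hkn).mono_set (Set.Ioi_subset_Ioi hX0.le)),
    Set.Ioc_union_Ioi_eq_Ioi hX0.le]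

end LaplacePowers

/-! ### Steps with a regularly varying tail -/

section Steps

lemma renewal_eq_sum {Ω : Type*} (Δ : ℕ → Ω → ℝ) (n : ℕ) :
    renewal Δ n = ∑ j ∈ Finset.range n, Δ j := by
  ext ω; simp [renewal]

variable {Ω : Type*} [MeasurableSpace Ω] {μ : Measure Ω}

lemma measureReal_map_eq {X : Ω → ℝ} (hX : AEMeasurable X μ) {s : Set ℝ} (hs : MeasurableSet s) :
    (μ.map X).real s = μ.real {ω | X ω ∈ s} := by
  rw [measureReal_def, Measure.map_apply_of_aemeasurable hX hs]; rfl

lemma integral_exp_neg_mul_renewal {Δ : ℕ → Ω → ℝ} (hi : iIndepFun Δ μ)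
    (hd : ∀ j, IdentDistrib (Δ j) (Δ 0) μ μ) (n : ℕ) (t : ℝ) :
    ∫ ω, Real.exp (-(t * renewal Δ n ω)) ∂μ = laplace (μ.map (Δ 0)) t ^ n := by
  have h0 : laplace (μ.map (Δ 0)) t = mgf (Δ 0) μ (-t) := by
    rw [laplace, integral_map (hd 0).aemeasurable_fst (by fun_prop)]
    simp [mgf]
  have h1 := hi.mgf_sum₀ (t := -t) (fun j => (hd j).aemeasurable_fst) (Finset.range n)
  rw [Finset.prod_congr rfl fun j _ => congrFun (mgf_congr_identDistrib (hd j)) (-t),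
    Finset.prod_const, Finset.card_range, ← h0] at h1
  rw [← h1, ← renewal_eq_sum]
  simp [mgf]

lemma lintegral_exp_neg_mul {T : ℝ} (hT : 0 < T) :
    ∫⁻ t in Set.Ioi (0 : ℝ), ENNReal.ofReal (Real.exp (-(t * T))) = ENNReal.ofReal T⁻¹ := by
  have e : (fun t : ℝ => Real.exp (-(t * T))) = fun t => Real.exp (-T * t) := by
    ext t; ring_nf
  rw [← ofReal_integral_eq_lintegral_ofReal]
  · rw [e, integral_exp_mul_Ioi (by linarith)]
    simp [neg_div_neg_eq]
  · rw [e]; exact integrableOn_exp_mul_Ioi (by linarith) 0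
  · exact ae_of_all _ fun t => (Real.exp_pos _).le

lemma aemeasurable_renewal {Δ : ℕ → Ω → ℝ} (hd : ∀ j, IdentDistrib (Δ j) (Δ 0) μ μ) (n : ℕ) :
    AEMeasurable (renewal Δ n) μ := by
  rw [renewal_eq_sum]
  exact Finset.aemeasurable_sum _ fun j _ => (hd j).aemeasurable_fst

lemma renewal_pos {Δ : ℕ → Ω → ℝ} (hpos : ∀ j, ∀ᵐ ω ∂μ, 0 < Δ j ω) {n : ℕ} (hn : 1 ≤ n) :
    ∀ᵐ ω ∂μ, 0 < renewal Δ n ω := by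
  filter_upwards [ae_all_iff.2 hpos] with ω h
  exact Finset.sum_pos (fun j _ => h j) (Finset.nonempty_range_iff.2 (by omega))

lemma ae_map_pos {Δ : ℕ → Ω → ℝ} (hd : ∀ j, IdentDistrib (Δ j) (Δ 0) μ μ)
    (hpos : ∀ j, ∀ᵐ ω ∂μ, 0 < Δ j ω) : ∀ᵐ x ∂(μ.map (Δ 0)), 0 < x :=
  (ae_map_iff (hd 0).aemeasurable_fst measurableSet_Ioi).2 (hpos 0)

/-- Inverse moments through the Laplace transform: `E [1 / T_n]` is the integral of the `n`-th power
of the Laplace transform of one step. Both sides may be infinite. -/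
lemma lintegral_inv_renewal [IsProbabilityMeasure μ] {Δ : ℕ → Ω → ℝ} (hi : iIndepFun Δ μ)
    (hd : ∀ j, IdentDistrib (Δ j) (Δ 0) μ μ) (hpos : ∀ j, ∀ᵐ ω ∂μ, 0 < Δ j ω) {n : ℕ}
    (hn : 1 ≤ n) :
    ∫⁻ ω, ENNReal.ofReal (renewal Δ n ω)⁻¹ ∂μ
      = ∫⁻ t in Set.Ioi (0 : ℝ), ENNReal.ofReal (laplace (μ.map (Δ 0)) t ^ n) := by
  have hT := aemeasurable_renewal hd n
  calc ∫⁻ ω, ENNReal.ofReal (renewal Δ n ω)⁻¹ ∂μ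
      = ∫⁻ ω, (∫⁻ t in Set.Ioi (0 : ℝ),
          ENNReal.ofReal (Real.exp (-(t * renewal Δ n ω)))) ∂μ := by
        refine lintegral_congr_ae ?_
        filter_upwards [renewal_pos hpos hn] with ω h using (lintegral_exp_neg_mul h).symm
    _ = ∫⁻ t in Set.Ioi (0 : ℝ), (∫⁻ ω,
          ENNReal.ofReal (Real.exp (-(t * renewal Δ n ω))) ∂μ) := by
        refine lintegral_lintegral_swap ?_
        have : AEMeasurable (fun p : Ω × ℝ => renewal Δ n p.1)
            (μ.prod (volume.restrict (Set.Ioi (0 : ℝ)))) := hT.comp_fst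
        exact (Real.measurable_exp.comp_aemeasurable
          ((measurable_snd.aemeasurable.mul this).neg)).ennreal_ofReal
    _ = _ := by
        refine setLIntegral_congr_fun measurableSet_Ioi fun t ht => ?_
        have hint : Integrable (fun ω => Real.exp (-(t * renewal Δ n ω))) μ := by
          refine Integrable.of_bound (Real.measurable_exp.comp_aemeasurable
            (hT.const_mul t).neg).aestronglyMeasurable 1 ?_
          filter_upwards [renewal_pos hpos hn] with ω h
          rw [Real.norm_of_nonneg (Real.exp_pos _).le, Real.exp_le_one_iff]
          have := mul_pos (Set.mem_Ioi.1 ht) h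
          linarith
        show _ = ENNReal.ofReal (laplace (μ.map (Δ 0)) t ^ n)
        rw [← integral_exp_neg_mul_renewal hi hd,
          ofReal_integral_eq_lintegral_ofReal hint (ae_of_all _ fun ω => (Real.exp_pos _).le)]

lemma integrable_inv_renewal_iff [IsProbabilityMeasure μ] {Δ : ℕ → Ω → ℝ} (hi : iIndepFun Δ μ)
    (hd : ∀ j, IdentDistrib (Δ j) (Δ 0) μ μ) (hpos : ∀ j, ∀ᵐ ω ∂μ, 0 < Δ j ω) {n : ℕ}
    (hn : 1 ≤ n) :
    Integrable (fun ω => (renewal Δ n ω)⁻¹) μ ↔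
      IntegrableOn (fun t => laplace (μ.map (Δ 0)) t ^ n) (Set.Ioi 0) := by
  have := Measure.isProbabilityMeasure_map (hd 0).aemeasurable_fst
  rw [← lintegral_ofReal_ne_top_iff_integrable (f := fun ω => (renewal Δ n ω)⁻¹)
      (aemeasurable_renewal hd n).inv.aestronglyMeasurable
      (by filter_upwards [renewal_pos hpos hn] with ω h using (inv_pos.2 h).le),
    IntegrableOn, ← lintegral_ofReal_ne_top_iff_integrable
      (measurable_laplace.pow_const n).aestronglyMeasurable
      (ae_of_all _ fun t => pow_nonneg (laplace_nonneg t) n),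
    lintegral_inv_renewal hi hd hpos hn]

lemma integral_inv_renewal [IsProbabilityMeasure μ] {Δ : ℕ → Ω → ℝ} (hi : iIndepFun Δ μ)
    (hd : ∀ j, IdentDistrib (Δ j) (Δ 0) μ μ) (hpos : ∀ j, ∀ᵐ ω ∂μ, 0 < Δ j ω) {n : ℕ}
    (hn : 1 ≤ n) :
    ∫ ω, (renewal Δ n ω)⁻¹ ∂μ = ∫ t in Set.Ioi 0, laplace (μ.map (Δ 0)) t ^ n := by
  have := Measure.isProbabilityMeasure_map (hd 0).aemeasurable_fst
  rw [integral_eq_lintegral_of_nonneg_ae (f := fun ω => (renewal Δ n ω)⁻¹)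
      (by filter_upwards [renewal_pos hpos hn] with ω h using (inv_pos.2 h).le)
      (aemeasurable_renewal hd n).inv.aestronglyMeasurable,
    integral_eq_lintegral_of_nonneg_ae
      (ae_of_all _ fun t => pow_nonneg (laplace_nonneg t) n)
      (measurable_laplace.pow_const n).aestronglyMeasurable,
    lintegral_inv_renewal hi hd hpos hn]

lemma integrable_inv_renewal_mono {Δ : ℕ → Ω → ℝ}
    (hd : ∀ j, IdentDistrib (Δ j) (Δ 0) μ μ) (hpos : ∀ j, ∀ᵐ ω ∂μ, 0 < Δ j ω) {m n : ℕ}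
    (hm : 1 ≤ m) (hmn : m ≤ n) (h : Integrable (fun ω => (renewal Δ m ω)⁻¹) μ) :
    Integrable (fun ω => (renewal Δ n ω)⁻¹) μ := by
  refine h.mono' (aemeasurable_renewal hd n).inv.aestronglyMeasurable ?_
  filter_upwards [ae_all_iff.2 hpos, renewal_pos hpos hm] with ω h1 h2
  have h3 : renewal Δ m ω ≤ renewal Δ n ω :=
    Finset.sum_le_sum_of_subset_of_nonneg (Finset.range_subset_range.2 hmn)
      fun j _ _ => (h1 j).le
  rw [Real.norm_of_nonneg (inv_nonneg.2 (h2.le.trans h3))]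
  exact inv_anti₀ h2 h3

namespace HeavyTailedSteps

variable {Δ : ℕ → Ω → ℝ} {ℓ : ℝ → ℝ} {b : ℕ → ℝ}

lemma lawTail_eq (h : HeavyTailedSteps μ Δ ℓ b) {x : ℝ} (hx : 1 ≤ x) :
    lawTail (μ.map (Δ 0)) x = x⁻¹ * ℓ x := by
  rw [lawTail, measureReal_map_eq (h.ident 0).aemeasurable_fst measurableSet_Ici, ← h.tail x hx]
  rfl

lemma tendsto_lawTail_mul_div (h : HeavyTailedSteps μ Δ ℓ b) (c : ℝ) (hc : 0 < c) :
    Tendsto (fun x => lawTail (μ.map (Δ 0)) (c * x) / lawTail (μ.map (Δ 0)) x) atTop (𝓝 c⁻¹) := by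
  have h1 := (h.slow.2 c hc).const_mul c⁻¹
  rw [mul_one] at h1
  refine h1.congr' ?_
  filter_upwards [eventually_ge_atTop 1, eventually_ge_atTop c⁻¹] with x hx hcx
  have hx0 : 0 < x := by linarith
  rw [h.lawTail_eq hx, h.lawTail_eq ((inv_le_iff_one_le_mul₀' hc).1 hcx)]
  field_simp

variable [IsProbabilityMeasure μ]

lemma isProbabilityMeasure_law (h : HeavyTailedSteps μ Δ ℓ b) :
    IsProbabilityMeasure (μ.map (Δ 0)) :=
  Measure.isProbabilityMeasure_map (h.ident 0).aemeasurable_fst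

lemma lawTail_pos (h : HeavyTailedSteps μ Δ ℓ b) (x : ℝ) : 0 < lawTail (μ.map (Δ 0)) x := by
  have := h.isProbabilityMeasure_law
  obtain ⟨X, -, hX⟩ := h.slow.1
  have h1 : (1 : ℝ) ≤ max x (max X 1) := (le_max_right _ _).trans (le_max_right _ _)
  refine lt_of_lt_of_le ?_ (lawTail_anti (le_max_left x (max X 1)))
  rw [h.lawTail_eq h1]
  exact mul_pos (inv_pos.2 (by linarith)) (hX _ ((le_max_left _ _).trans (le_max_right _ _)))

lemma one_le_mul_lawTail (h : HeavyTailedSteps μ Δ ℓ b) {n : ℕ} (hn : 1 ≤ n) :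
    1 ≤ n * lawTail (μ.map (Δ 0)) (b n) := by
  have := h.isProbabilityMeasure_law
  have h1 := (h.quantile n hn).1
  have hn0 : (0 : ℝ) < n := by exact_mod_cast hn
  have h2 : (μ.map (Δ 0)).real (Set.Iio (b n)) ≤ 1 - 1 / n := by
    rw [measureReal_map_eq (h.ident 0).aemeasurable_fst measurableSet_Iio]; exact h1
  have h3 : lawTail (μ.map (Δ 0)) (b n) = 1 - (μ.map (Δ 0)).real (Set.Iio (b n)) := by
    rw [lawTail, ← Set.compl_Iio, probReal_compl_eq_one_sub measurableSet_Iio]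
  have h4 : 1 / (n : ℝ) ≤ lawTail (μ.map (Δ 0)) (b n) := by linarith
  rwa [div_le_iff₀' hn0] at h4

lemma mul_lawTail_le_one (h : HeavyTailedSteps μ Δ ℓ b) {n : ℕ} (hn : 1 ≤ n) {x : ℝ}
    (hx : b n < x) : n * lawTail (μ.map (Δ 0)) x ≤ 1 := by
  have := h.isProbabilityMeasure_law
  have h1 := (h.quantile n hn).2
  have hn0 : (0 : ℝ) < n := by exact_mod_cast hn
  have h2 : 1 - 1 / n ≤ (μ.map (Δ 0)).real (Set.Iic (b n)) := by
    rw [measureReal_map_eq (h.ident 0).aemeasurable_fst measurableSet_Iic]; exact h1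
  have h3 : (μ.map (Δ 0)).real (Set.Ioi (b n)) = 1 - (μ.map (Δ 0)).real (Set.Iic (b n)) := by
    rw [← Set.compl_Iic, probReal_compl_eq_one_sub measurableSet_Iic]
  have h4 : lawTail (μ.map (Δ 0)) x ≤ (μ.map (Δ 0)).real (Set.Ioi (b n)) :=
    measureReal_mono (Set.Ici_subset_Ioi.2 hx)
  have h5 : lawTail (μ.map (Δ 0)) x ≤ 1 / n := by linarith
  rwa [le_div_iff₀' hn0] at h5

lemma tendsto_quantile (h : HeavyTailedSteps μ Δ ℓ b) : Tendsto b atTop atTop := by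
  refine tendsto_atTop.2 fun M => ?_
  obtain ⟨N, hN⟩ := exists_nat_gt (lawTail (μ.map (Δ 0)) M)⁻¹
  filter_upwards [eventually_ge_atTop N, eventually_ge_atTop 1] with n hn hn1
  by_contra! hlt
  have h1 := h.mul_lawTail_le_one hn1 hlt
  have hM := h.lawTail_pos M
  rw [inv_lt_iff_one_lt_mul₀ hM] at hN
  have : (N : ℝ) * lawTail (μ.map (Δ 0)) M ≤ n * lawTail (μ.map (Δ 0)) M := by gcongr
  linarith

/-- The law may have an atom at `b_n`, but a regularly varying tail makes atoms negligible. -/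
lemma tendsto_mul_lawTail (h : HeavyTailedSteps μ Δ ℓ b) :
    Tendsto (fun n : ℕ => n * lawTail (μ.map (Δ 0)) (b n)) atTop (𝓝 1) := by
  refine tendsto_order.2 ⟨fun c hc => ?_, fun c hc => ?_⟩
  · filter_upwards [eventually_ge_atTop 1] with n hn
    exact hc.trans_le (h.one_le_mul_lawTail hn)
  · obtain ⟨d, hd1, hdc⟩ := exists_between hc
    have hd0 : 0 < d := by linarith
    have h1 := ((h.tendsto_lawTail_mul_div d hd0).comp h.tendsto_quantile).eventually_const_lt
      (inv_strictAnti₀ hd0 hdc)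
    filter_upwards [h1, eventually_ge_atTop 1, h.tendsto_quantile.eventually_gt_atTop 0]
      with n h2 hn hb
    have h3 := h.mul_lawTail_le_one hn (show b n < d * b n by nlinarith)
    simp only [Function.comp] at h2
    rw [lt_div_iff₀ (h.lawTail_pos _)] at h2
    have hn0 : (0 : ℝ) < n := by exact_mod_cast hn
    have h4 := (mul_lt_mul_of_pos_left h2 hn0).trans_le h3
    have hc0 : 0 < c := by linarith
    have h5 := mul_lt_mul_of_pos_left h4 hc0
    have e : c * (n * (c⁻¹ * lawTail (μ.map (Δ 0)) (b n)))
        = n * lawTail (μ.map (Δ 0)) (b n) := by field_simp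
    linarith

/-- Only levels at least `1` are compared, as the tail is tied to `ℓ` on `[1, ∞)` alone. -/
lemma ellStar_eq (h : HeavyTailedSteps μ Δ ℓ b) {y : ℝ} (hy : 1 ≤ y) :
    ellStar ℓ y = truncMean (μ.map (Δ 0)) y - truncMean (μ.map (Δ 0)) 1 := by
  have := h.isProbabilityMeasure_law
  have hp := ae_map_pos h.ident h.pos
  rw [truncMean_eq_integral hp (by linarith), truncMean_eq_integral hp zero_le_one,
    intervalIntegral.integral_interval_sub_left (intervalIntegrable_lawTail _ _)
      (intervalIntegrable_lawTail _ _), ellStar]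
  refine intervalIntegral.integral_congr fun x hx => ?_
  rw [Set.uIcc_of_le hy] at hx
  show ℓ x / x = _
  rw [h.lawTail_eq hx.1, div_eq_inv_mul]

lemma tendsto_ellStar_div_truncMean (h : HeavyTailedSteps μ Δ ℓ b) :
    Tendsto (fun n => ellStar ℓ (b n) / truncMean (μ.map (Δ 0)) (b n)) atTop (𝓝 1) := by
  have := h.isProbabilityMeasure_law
  have hp := ae_map_pos h.ident h.pos
  have hinf : ∫⁻ x, ENNReal.ofReal x ∂(μ.map (Δ 0)) = ⊤ := by
    rw [lintegral_map' (by fun_prop) (h.ident 0).aemeasurable_fst]; exact h.mean_infinite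
  have hm := (tendsto_truncMean hp hinf).comp h.tendsto_quantile
  have h1 := (hm.inv_tendsto_atTop.const_mul (truncMean (μ.map (Δ 0)) 1)).const_sub 1
  rw [mul_zero, sub_zero] at h1
  refine h1.congr' ?_
  filter_upwards [h.tendsto_quantile.eventually_ge_atTop 1, hm.eventually_gt_atTop 0] with n h2 h3
  simp only [Function.comp, Pi.inv_apply] at h3 ⊢
  rw [h.ellStar_eq h2]
  field_simp

lemma tendsto_natCast_mul_div (h : HeavyTailedSteps μ Δ ℓ b) :
    Tendsto (fun n : ℕ => n * ℓ (b n) / b n) atTop (𝓝 1) := by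
  refine h.tendsto_mul_lawTail.congr' ?_
  filter_upwards [h.tendsto_quantile.eventually_ge_atTop 1] with n hn
  rw [h.lawTail_eq hn]
  ring

/-- The limit in its simplest normalization, `ℓ* (b_n) E [n / T_n] → 1`. -/
lemma tendsto_ellStar_mul_integral (h : HeavyTailedSteps μ Δ ℓ b)
    (hm : ∃ m : ℕ, 1 ≤ m ∧ Integrable (fun ω => (renewal Δ m ω)⁻¹) μ) :
    Tendsto (fun n : ℕ => ellStar ℓ (b n) * (n * ∫ ω, (renewal Δ n ω)⁻¹ ∂μ)) atTop (𝓝 1) := by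
  have := h.isProbabilityMeasure_law
  obtain ⟨m, hm1, hm⟩ := hm
  have hp := ae_map_pos h.ident h.pos
  have h1 := tendsto_integral_laplace_pow hp h.lawTail_pos h.tendsto_lawTail_mul_div
    h.tendsto_quantile h.tendsto_mul_lawTail
    ((integrable_inv_renewal_iff h.indep h.ident h.pos hm1).1 hm)
  have h2 := h.tendsto_ellStar_div_truncMean.mul h1
  rw [one_mul] at h2
  refine h2.congr' ?_
  filter_upwards [eventually_ge_atTop 1, h.tendsto_quantile.eventually_gt_atTop 0] with n hn hb
  rw [integral_inv_renewal h.indep h.ident h.pos hn]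
  have := truncMean_pos hp h.lawTail_pos hb
  field_simp

lemma tendsto_integral_inv_normalized (h : HeavyTailedSteps μ Δ ℓ b)
    (hm : ∃ m : ℕ, 1 ≤ m ∧ Integrable (fun ω => (renewal Δ m ω)⁻¹) μ) :
    Tendsto (fun n : ℕ => b n * ellStar ℓ (b n) / (n * ℓ (b n)) *
      (n * ∫ ω, (renewal Δ n ω)⁻¹ ∂μ)) atTop (𝓝 1) := by
  have h1 := (h.tendsto_natCast_mul_div.inv₀ one_ne_zero).mul (h.tendsto_ellStar_mul_integral hm)
  rw [inv_one, one_mul] at h1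
  refine h1.congr fun n => ?_
  rw [inv_div]
  ring

theorem inverse_moment_limit (h : HeavyTailedSteps μ Δ ℓ b)
    (hm : ∃ m : ℕ, 1 ≤ m ∧ Integrable (fun ω => (renewal Δ m ω)⁻¹) μ) :
    (∀ᶠ n : ℕ in atTop,
        Integrable (fun ω => (renewal Δ n ω / b n * (ℓ (b n) / ellStar ℓ (b n)))⁻¹) μ) ∧
      Tendsto (fun n : ℕ => ∫ ω, (renewal Δ n ω / b n * (ℓ (b n) / ellStar ℓ (b n)))⁻¹ ∂μ)
        atTop (𝓝 1) := by
  have e : ∀ n : ℕ, (fun ω => (renewal Δ n ω / b n * (ℓ (b n) / ellStar ℓ (b n)))⁻¹)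
      = fun ω => b n * ellStar ℓ (b n) / ℓ (b n) * (renewal Δ n ω)⁻¹ := by
    intro n; ext ω
    rw [mul_inv, inv_div, inv_div]; ring
  have hlim := h.tendsto_integral_inv_normalized hm
  obtain ⟨m, hm1, hm⟩ := hm
  constructor
  · filter_upwards [eventually_ge_atTop m] with n hn
    rw [e]
    exact (integrable_inv_renewal_mono h.ident h.pos hm1 hn hm).const_mul _
  · refine hlim.congr' ?_
    filter_upwards [eventually_ge_atTop 1] with n hn
    have hn0 : (n : ℝ) ≠ 0 := by positivity
    rw [e, integral_const_mul]
    field_simp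

/-! ### Harmonic means -/

theorem harmonicMean_limit {V : ℕ → Ω → ℝ} (hV : ∀ j, ∀ᵐ ω ∂μ, 0 < V j ω ∧ V j ω ≤ 1)
    (h : HeavyTailedSteps μ (fun j ω => 1 / V j ω) ℓ b) :
    (∀ n : ℕ, Integrable (harmonicMean V n) μ) ∧
      Tendsto (fun n : ℕ => b n * ellStar ℓ (b n) / (n * ℓ (b n)) * ∫ ω, harmonicMean V n ω ∂μ)
        atTop (𝓝 1) ∧
      Tendsto (fun n : ℕ => ellStar ℓ (b n) * ∫ ω, harmonicMean V n ω ∂μ) atTop (𝓝 1) := by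
  have e : ∀ n, harmonicMean V n = fun ω => n * (renewal (fun j ω => 1 / V j ω) n ω)⁻¹ := by
    intro n; ext ω; rw [harmonicMean, renewal, div_eq_mul_inv]
  have h1 : Integrable (fun ω => (renewal (fun j ω => 1 / V j ω) 1 ω)⁻¹) μ := by
    refine Integrable.of_bound (aemeasurable_renewal h.ident 1).inv.aestronglyMeasurable 1 ?_
    filter_upwards [hV 0] with ω hω
    simpa [renewal, abs_of_pos hω.1] using hω.2
  have hm : ∃ m : ℕ, 1 ≤ m ∧ Integrable (fun ω => (renewal (fun j ω => 1 / V j ω) m ω)⁻¹) μ :=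
    ⟨1, le_rfl, h1⟩
  refine ⟨fun n => ?_, ?_, ?_⟩
  · rw [e]
    rcases Nat.eq_zero_or_pos n with rfl | hn
    · simp
    · exact (integrable_inv_renewal_mono h.ident h.pos le_rfl hn h1).const_mul _
  · simp_rw [e, integral_const_mul]
    exact h.tendsto_integral_inv_normalized hm
  · simp_rw [e, integral_const_mul]
    exact h.tendsto_ellStar_mul_integral hm

end HeavyTailedSteps

/-! ### Uniform variables -/

section Uniform

lemma map_eq_restrict_of_isUniform {U : Ω → ℝ}
    (hU : pdf.IsUniform U (Set.Ioo (0 : ℝ) 1) μ volume) :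
    μ.map U = volume.restrict (Set.Ioc (0 : ℝ) 1) := by
  have h : μ.map U = ProbabilityTheory.cond volume (Set.Ioo (0 : ℝ) 1) := hU
  rw [h, ProbabilityTheory.cond]
  simp [restrict_Ioo_eq_restrict_Ioc]

lemma aemeasurable_of_isUniform {U : Ω → ℝ}
    (hU : pdf.IsUniform U (Set.Ioo (0 : ℝ) 1) μ volume) : AEMeasurable U μ :=
  pdf.IsUniform.aemeasurable (by simp) (by simp) hU

lemma ae_mem_of_isUniform {U : Ω → ℝ}
    (hU : pdf.IsUniform U (Set.Ioo (0 : ℝ) 1) μ volume) : ∀ᵐ ω ∂μ, 0 < U ω ∧ U ω ≤ 1 := by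
  refine ae_of_ae_map (aemeasurable_of_isUniform hU) (p := fun u => 0 < u ∧ u ≤ 1) ?_
  rw [map_eq_restrict_of_isUniform hU]
  exact ae_restrict_mem measurableSet_Ioc

lemma measureReal_le_one_div_of_isUniform {U : Ω → ℝ}
    (hU : pdf.IsUniform U (Set.Ioo (0 : ℝ) 1) μ volume) {x : ℝ} (hx : 1 ≤ x) :
    μ.real {ω | x ≤ 1 / U ω} = x⁻¹ := by
  have hm : MeasurableSet {u : ℝ | x ≤ 1 / u} := measurableSet_le (by fun_prop) (by fun_prop)
  have h1 := measureReal_map_eq (aemeasurable_of_isUniform hU) hm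
  have h2 : {u : ℝ | x ≤ 1 / u} ∩ Set.Ioc 0 1 = Set.Ioc 0 x⁻¹ := by
    have hx0 : 0 < x := by linarith
    ext u
    simp only [Set.mem_inter_iff, Set.mem_ofPred_eq, Set.mem_Ioc, one_div]
    constructor
    · rintro ⟨h3, h4, -⟩
      exact ⟨h4, (le_inv_comm₀ hx0 h4).1 h3⟩
    · rintro ⟨h3, h4⟩
      exact ⟨(le_inv_comm₀ hx0 h3).2 h4, h3, h4.trans (inv_le_one_of_one_le₀ hx)⟩
  rw [map_eq_restrict_of_isUniform hU, measureReal_restrict_apply hm, h2] at h1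
  refine h1.symm.trans ?_
  simp only [Real.volume_real_Ioc, sub_zero]
  exact max_eq_left (inv_nonneg.2 (by linarith))

lemma lintegral_one_div_of_isUniform {U : Ω → ℝ}
    (hU : pdf.IsUniform U (Set.Ioo (0 : ℝ) 1) μ volume) :
    ∫⁻ ω, ENNReal.ofReal (1 / U ω) ∂μ = ⊤ := by
  have h1 := lintegral_map' (μ := μ) (f := fun u : ℝ => ENNReal.ofReal (1 / u)) (g := U)
    (by fun_prop) (aemeasurable_of_isUniform hU)
  rw [← h1, map_eq_restrict_of_isUniform hU]
  by_contra hne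
  rw [← ne_eq, lintegral_ofReal_ne_top_iff_integrable (by fun_prop)] at hne
  · have : IntervalIntegrable (fun u : ℝ => u⁻¹) volume 0 1 := by
      rw [intervalIntegrable_iff_integrableOn_Ioc_of_le zero_le_one]
      exact hne.congr (ae_of_all _ fun u => one_div u)
    simp [intervalIntegrable_inv_iff] at this
  · filter_upwards [ae_restrict_mem measurableSet_Ioc] with u hu
    exact one_div_nonneg.2 hu.1.le

lemma heavyTailedSteps_of_isUniform [IsProbabilityMeasure μ] {U : ℕ → Ω → ℝ} (hi : iIndepFun U μ)
    (hU : ∀ j, pdf.IsUniform (U j) (Set.Ioo (0 : ℝ) 1) μ volume) :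
    HeavyTailedSteps μ (fun j ω => 1 / U j ω) (fun _ => 1) (fun n => (n : ℝ)) where
  indep := hi.comp (fun _ u => 1 / u) fun _ => by fun_prop
  ident j := IdentDistrib.comp (u := fun u : ℝ => 1 / u)
    ⟨aemeasurable_of_isUniform (hU j), aemeasurable_of_isUniform (hU 0), (hU j).trans (hU 0).symm⟩
    (by fun_prop)
  pos j := by
    filter_upwards [ae_mem_of_isUniform (hU j)] with ω h using one_div_pos.2 h.1
  mean_infinite := lintegral_one_div_of_isUniform (hU 0)
  slow := ⟨⟨0, measurable_const, fun _ _ => one_pos⟩, fun c _ => by simp⟩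
  tail x hx := by rw [measureReal_le_one_div_of_isUniform (hU 0) hx, mul_one]
  quantile n hn := by
    have h1 := measureReal_le_one_div_of_isUniform (hU 0) (x := n) (by exact_mod_cast hn)
    have hm : NullMeasurableSet {ω | (n : ℝ) ≤ 1 / U 0 ω} μ :=
      nullMeasurableSet_le aemeasurable_const ((aemeasurable_of_isUniform (hU 0)).const_div 1)
    have h2 : μ.real {ω | 1 / U 0 ω < n} = 1 - 1 / (n : ℝ) := by
      have e : {ω | 1 / U 0 ω < n} = {ω | (n : ℝ) ≤ 1 / U 0 ω}ᶜ := by ext ω; simp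
      rw [e, probReal_compl_eq_one_sub₀ hm, h1, one_div]
    exact ⟨h2.le, h2.ge.trans (measureReal_mono
      fun ω (hω : 1 / U 0 ω < n) => show 1 / U 0 ω ≤ n from hω.le)⟩

lemma ellStar_one {n : ℕ} (hn : 1 ≤ n) : ellStar (fun _ => 1) (n : ℝ) = Real.log n := by
  rw [ellStar, integral_one_div_of_pos one_pos (by exact_mod_cast hn), div_one]

end Uniform

end Steps
theorem mainTheorem4 {Ω : Type*} [MeasurableSpace Ω] (μ : Measure Ω) [IsProbabilityMeasure μ] :
    -- the limit for steps with tail index 1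
    (∀ (Δ : ℕ → Ω → ℝ) (ℓ : ℝ → ℝ) (b : ℕ → ℝ), HeavyTailedSteps μ Δ ℓ b →
      (∃ m : ℕ, 1 ≤ m ∧ Integrable (fun ω => (renewal Δ m ω)⁻¹) μ) →
      (∀ᶠ n : ℕ in atTop,
        Integrable (fun ω => (renewal Δ n ω / b n * (ℓ (b n) / ellStar ℓ (b n)))⁻¹) μ) ∧
      Tendsto (fun n : ℕ => ∫ ω, (renewal Δ n ω / b n * (ℓ (b n) / ellStar ℓ (b n)))⁻¹ ∂μ)
        atTop (𝓝 1)) ∧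
    -- harmonic means of random variables in the unit interval
    (∀ (V : ℕ → Ω → ℝ) (ℓ : ℝ → ℝ) (b : ℕ → ℝ),
      (∀ j, ∀ᵐ ω ∂μ, 0 < V j ω ∧ V j ω ≤ 1) →
      HeavyTailedSteps μ (fun j ω => 1 / V j ω) ℓ b →
      (∀ n : ℕ, Integrable (harmonicMean V n) μ) ∧
      Tendsto (fun n : ℕ => b n * ellStar ℓ (b n) / (n * ℓ (b n)) * ∫ ω, harmonicMean V n ω ∂μ)
        atTop (𝓝 1) ∧
      Tendsto (fun n : ℕ => ellStar ℓ (b n) * ∫ ω, harmonicMean V n ω ∂μ) atTop (𝓝 1)) ∧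
    -- the uniform distribution as a special case, with `ℓ = 1`, `b n = n`, `ℓ* = log`
    (∀ U : ℕ → Ω → ℝ, iIndepFun U μ →
      (∀ j, pdf.IsUniform (U j) (Set.Ioo (0 : ℝ) 1) μ volume) →
      HeavyTailedSteps μ (fun j ω => 1 / U j ω) (fun _ => 1) (fun n => (n : ℝ)) ∧
      (∀ n : ℕ, 1 ≤ n → ellStar (fun _ => 1) (n : ℝ) = Real.log n) ∧
      (∀ n : ℕ, Integrable (harmonicMean U n) μ) ∧
      Tendsto (fun n : ℕ => Real.log n * ∫ ω, harmonicMean U n ω ∂μ) atTop (𝓝 1)) := by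
  refine ⟨fun Δ ℓ b h hm => h.inverse_moment_limit hm,
    fun V ℓ b hV h => h.harmonicMean_limit hV, fun U hi hU => ?_⟩
  have h := heavyTailedSteps_of_isUniform hi hU
  obtain ⟨h1, -, h2⟩ := h.harmonicMean_limit fun j => ae_mem_of_isUniform (hU j)
  refine ⟨h, fun n hn => ellStar_one hn, h1, h2.congr' ?_⟩
  filter_upwards [eventually_ge_atTop 1] with n hn
  rw [ellStar_one hn]
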